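/- Let $n\ge 1$ and let $K\subseteq\mathbb R^n$ be a proper cone, i.e. a closed convex cone with $K\cap(-K)=\{0\}$ and nonempty interior. Let $\pi(K)$ be the set of real $n\times n$ matrices $A$ with $AK\subseteq K$. Regard real matrices and vectors also as complex ones, and let $\rho(A)$ denote the spectral radius of $A$. For $0\ne x\in\mathbb C^n$ write $x=x_1+\cdots+x_k$ (uniquely, up to the order of the terms) as a sum of generalized eigenvectors of $A$ corresponding to distinct eigenvalues $\lambda_1,\dots,\lambda_k\in\mathbb C$; this is called the representation of $x$. The local spectral radius of $A$ at $x$ is $\rho_x(A)=\max_j|\lambda_j|$. The order of a generalized eigenvector $v$ for the eigenvalue $\lambda$ is the least positive integer $p$ with $(A-\lambda I)^p v=0$, and $\mathrm{ord}_A(x)$ is the maximum of the orders of those $x_j$ with $|\lambda_j|=\rho_x(A)$. **Theorem 6.1.** Let $A\in\pi(K)$, let $0\ne x\in K$ have the representation $x=x_1+\cdots+x_k$ with distinct eigenvalues $\lambda_1,\dots,\lambda_k$, and let $$\Gamma=\{j : |\lambda_j|=\rho_x(A),\ \lambda_j\ne\rho_x(A)\}.$$ Let $m$ be a positive integer with $(A-\rho_x(A)I)^m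 x\in K$ and $0\ne(A-\rho_x(A)I)^j x\in K$ for $j=0,\dots,m-1$. Then $m\le \mathrm{ord}_A(x)$. If moreover $\Gamma\ne\emptyset$, then $$m\le \mathrm{ord}_A(x)-\max_{j\in\Gamma}\mathrm{ord}_A(x_j).$$ **Corollary 6.3.** Let $A\in\pi(K)$ and let $\lambda$ be a real number. Then $\lambda<\rho(A)$ if and only if there exists $x\in K$ such that $0\ne(A-\lambda I)^j x\in K$ for all positive integers $j$. -/

import Mathlib

namespace ConePreserving

/-- A convex cone `K` of `ℝⁿ` (Mathlib's `PointedCone` is a convex cone containing `0`) is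
*proper* if it is closed, satisfies `K ∩ (-K) = {0}`, and has nonempty interior. -/
structure IsProper {n : ℕ} (K : PointedCone ℝ (Fin n → ℝ)) : Prop where
  isClosed : IsClosed (K : Set (Fin n → ℝ))
  eq_zero_of_neg_mem : ∀ x ∈ K, -x ∈ K → x = 0
  interior_nonempty : (interior (K : Set (Fin n → ℝ))).Nonempty

/-- `π(K)`: the real matrices `A` with `A K ⊆ K`. -/
def preservers {n : ℕ} (K : PointedCone ℝ (Fin n → ℝ)) : Set (Matrix (Fin n) (Fin n) ℝ) :=
  {A | ∀ x ∈ K, A.mulVec x ∈ K}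

/-- A real matrix seen as a complex matrix. -/
def cMat {n : ℕ} (A : Matrix (Fin n) (Fin n) ℝ) : Matrix (Fin n) (Fin n) ℂ :=
  A.map (fun a => (a : ℂ))

/-- A real vector seen as a complex vector. -/
def cVec {n : ℕ} (x : Fin n → ℝ) : Fin n → ℂ := fun i => (x i : ℂ)

/-- The spectral radius `ρ(A)` of a complex matrix, as a real number. -/
noncomputable def rho {n : ℕ} (A : Matrix (Fin n) (Fin n) ℂ) : ℝ :=
  (spectralRadius ℂ A).toReal

/-- `f` is a representation of `x` as a sum of generalized eigenvectors of `A` for distinct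
eigenvalues: the eigenvalues that occur are the elements of `f.support`, and for each such `μ`
the nonzero vector `f μ` is the generalized eigenvector of `A` for `μ` in the sum. -/
def IsGenEigenRep {n : ℕ} (A : Matrix (Fin n) (Fin n) ℂ) (x : Fin n → ℂ)
    (f : ℂ →₀ (Fin n → ℂ)) : Prop :=
  (∀ μ : ℂ, f μ ∈ Module.End.maxGenEigenspace (Matrix.toLin' A) μ) ∧
    (f.sum fun _ v => v) = x

theorem existsUnique_isGenEigenRep {n : ℕ} (A : Matrix (Fin n) (Fin n) ℂ) (x : Fin n → ℂ) :
    ∃! f : ℂ →₀ (Fin n → ℂ), IsGenEigenRep A x f := by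
  have hx : x ∈ ⨆ μ : ℂ, Module.End.maxGenEigenspace (Matrix.toLin' A) μ := by
    rw [Module.End.iSup_maxGenEigenspace_eq_top]; trivial
  obtain ⟨f, hf, hs⟩ := (Submodule.mem_iSup_iff_exists_finsupp _ _).1 hx
  refine ⟨f, ⟨hf, hs⟩, ?_⟩
  rintro g ⟨hg, hgs⟩
  have hind := Module.End.independent_maxGenEigenspace (Matrix.toLin' A)
  have key : ∀ s : Finset ℂ, ∀ h : ℂ → (Fin n → ℂ),
      (∀ μ, h μ ∈ Module.End.maxGenEigenspace (Matrix.toLin' A) μ) →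
      ∑ μ ∈ s, h μ = 0 → ∀ μ ∈ s, h μ = 0 := by
    intro s h hh h0 μ hμ
    have hd := (iSupIndep_def.1 hind) μ
    rw [Submodule.disjoint_def] at hd
    refine hd _ (hh μ) ?_
    rw [← Finset.add_sum_erase s h hμ] at h0
    rw [eq_neg_of_add_eq_zero_left h0]
    refine Submodule.neg_mem _ (Submodule.sum_mem _ fun ν hν => ?_)
    exact Submodule.mem_iSup_of_mem ν
      (Submodule.mem_iSup_of_mem (Finset.ne_of_mem_erase hν) (hh ν))
  classical
  have hsub : ∑ μ ∈ g.support ∪ f.support, (g μ - f μ) = 0 := by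
    rw [Finset.sum_sub_distrib,
      ← Finsupp.sum_of_support_subset g Finset.subset_union_left (fun _ v => v) (by simp),
      ← Finsupp.sum_of_support_subset f Finset.subset_union_right (fun _ v => v) (by simp),
      hgs, hs, sub_self]
  ext1 μ
  by_cases hμ : μ ∈ g.support ∪ f.support
  · exact sub_eq_zero.1 (key _ (fun μ => g μ - f μ)
      (fun μ => Submodule.sub_mem _ (hg μ) (hf μ)) hsub μ hμ)
  · simp only [Finset.mem_union, Finsupp.mem_support_iff, not_or, not_not] at hμ
    rw [hμ.1, hμ.2]

/-- The representation of `x` as a sum of generalized eigenvectors of `A`. -/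
noncomputable def genEigenRep {n : ℕ} (A : Matrix (Fin n) (Fin n) ℂ) (x : Fin n → ℂ) :
    ℂ →₀ (Fin n → ℂ) :=
  (existsUnique_isGenEigenRep A x).choose

theorem isGenEigenRep_genEigenRep {n : ℕ} (A : Matrix (Fin n) (Fin n) ℂ) (x : Fin n → ℂ) :
    IsGenEigenRep A x (genEigenRep A x) :=
  (existsUnique_isGenEigenRep A x).choose_spec.1

theorem IsGenEigenRep.eq_genEigenRep {n : ℕ} {A : Matrix (Fin n) (Fin n) ℂ} {x : Fin n → ℂ}
    {f : ℂ →₀ (Fin n → ℂ)} (hf : IsGenEigenRep A x f) : f = genEigenRep A x :=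
  (existsUnique_isGenEigenRep A x).choose_spec.2 f hf

/-- The local spectral radius `ρ_x(A)`: the largest modulus of an eigenvalue that occurs in the
representation of `x` as a sum of generalized eigenvectors of `A`, and `0` for `x = 0`. -/
noncomputable def localRho {n : ℕ} (A : Matrix (Fin n) (Fin n) ℂ) (x : Fin n → ℂ) : ℝ :=
  ((genEigenRep A x).support.sup fun μ => ‖μ‖₊ : NNReal)

/-- The order of a generalized eigenvector `v` of `A` for the eigenvalue `μ`: the least positive
integer `p` with `(A - μ I)^p v = 0`. -/
noncomputable def genEigenOrder {n : ℕ} (A : Matrix (Fin n) (Fin n) ℂ) (μ : ℂ)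
    (v : Fin n → ℂ) : ℕ :=
  sInf {p : ℕ | 0 < p ∧ ((A - μ • (1 : Matrix (Fin n) (Fin n) ℂ)) ^ p).mulVec v = 0}

open Classical in
/-- `ord_A(x)`: the maximum of the orders of the generalized eigenvectors in the representation
of `x` that belong to eigenvalues of modulus `ρ_x(A)`, and `0` for `x = 0`. -/
noncomputable def ord {n : ℕ} (A : Matrix (Fin n) (Fin n) ℂ) (x : Fin n → ℂ) : ℕ :=
  ((genEigenRep A x).support.filter fun μ => ‖μ‖ = localRho A x).sup
    fun μ => genEigenOrder A μ (genEigenRep A x μ)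

open Classical in
/-- `Γ`: the eigenvalues `μ` that occur in the representation of `x` as a sum of generalized
eigenvectors of `A` and satisfy `|μ| = ρ_x(A)` and `μ ≠ ρ_x(A)`. -/
noncomputable def Gam {n : ℕ} (A : Matrix (Fin n) (Fin n) ℂ) (x : Fin n → ℂ) : Finset ℂ :=
  (genEigenRep A x).support.filter fun μ => ‖μ‖ = localRho A x ∧ μ ≠ (localRho A x : ℂ)

/-- The vector `(A - r I)^j x`. -/
def shiftPow {n : ℕ} (A : Matrix (Fin n) (Fin n) ℝ) (r : ℝ) (j : ℕ) (x : Fin n → ℝ) :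
    Fin n → ℝ :=
  ((A - r • (1 : Matrix (Fin n) (Fin n) ℝ)) ^ j).mulVec x

end ConePreserving

/-! Write `ρ` for the local spectral radius of `x`. For `|z| > ρ` the series `∑ Aᵏx / z^(k+1)` is a
finite sum of partial fractions whose pole at an eigenvalue `μ` has order equal to the order of the
component `x_μ`. If all `Aᵏx` lie in `K`, a functional `g` with `c‖y‖ ≤ g y` on `K` bounds the
series at `tω`, `|ω| = 1`, by a constant times its value at `t`. So no pole on the circle `|z| = ρ`
has larger order than the one at `ρ` (`IsGenEigenRep.pow_sub_apply_eq_zero_of_norm_eq`).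

Apply this to `(A - ρ)ᵐx ∈ K`. The factor `(A - ρ)ᵐ` lowers the order at `ρ` by `m` and keeps the
orders at `μ ≠ ρ`, which gives the bound when `Γ` is nonempty. If `Γ` is empty, `z = (A - ρ)^(m-1)
x` satisfies `Az - ρz ∈ K`, so `z` still has an eigenvalue of modulus at least `ρ`; this can only be
`ρ`, so `(A - ρ)^(m-1)` does not kill `x_ρ`.

For the corollary, the leading coefficient at `ρ` is an eigenvector in `K`. One direction uses a
Perron eigenvector of `A`; the other applies the same local result to `A - λ`. -/

open Filter Topology

namespace ConePreserving

/-! ### Partial fractions of the resolvent series -/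

section Resolvent

variable {V : Type*} [NormedAddCommGroup V] [NormedSpace ℂ V]

theorem hasSum_choose_mul_pow_mul_inv_pow (i : ℕ) {μ z : ℂ} (h : ‖μ‖ < ‖z‖) :
    HasSum (fun k : ℕ => (k.choose i : ℂ) * μ ^ (k - i) * (z ^ (k + 1))⁻¹)
      ((z - μ) ^ (i + 1))⁻¹ := by
  have hz : z ≠ 0 := norm_pos_iff.1 ((norm_nonneg μ).trans_lt h)
  have hr : ‖μ / z‖ < 1 := by
    rw [norm_div]; exact (div_lt_one (norm_pos_iff.2 hz)).2 h
  have hs := (hasSum_choose_mul_geometric_of_norm_lt_one i hr).mul_left ((z ^ (i + 1))⁻¹)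
  -- The terms with `k < i` vanish, so the sum may be reindexed by `k + i`.
  rw [← (add_left_injective i).hasSum_iff]
  · convert! hs using 1
    · ext k
      simp only [Function.comp_apply, Nat.add_sub_cancel, div_pow]
      field_simp
      ring
    · rw [one_div, ← mul_inv, ← mul_pow, mul_sub, mul_one, mul_div_cancel₀ _ hz]
  · intro k hk
    have : k < i := by
      by_contra hki
      exact hk ⟨k - i, by simp; omega⟩
    simp [Nat.choose_eq_zero_of_lt this]

/-- The power series `∑ Tᵏ v / z^(k+1)` of the resolvent at a generalized eigenvector `v`. -/
theorem hasSum_inv_pow_smul_pow_apply (T : Module.End ℂ V) {μ z : ℂ} (h : ‖μ‖ < ‖z‖) {d : ℕ}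
    {v : V} (hv : ((T - μ • 1) ^ d) v = 0) :
    HasSum (fun k : ℕ => (z ^ (k + 1))⁻¹ • (T ^ k) v)
      (∑ i ∈ Finset.range d, ((z - μ) ^ (i + 1))⁻¹ • ((T - μ • 1) ^ i) v) := by
  have hpow : ∀ k : ℕ, (T ^ k) v =
      ∑ i ∈ Finset.range d, ((k.choose i : ℂ) * μ ^ (k - i)) • ((T - μ • 1) ^ i) v := by
    intro k
    have hc : Commute (T - μ • (1 : Module.End ℂ V)) (μ • 1) :=
      (Commute.one_right _).smul_right μ
    have h1 : (T ^ k) v =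
        ∑ i ∈ Finset.range (k + 1), ((k.choose i : ℂ) * μ ^ (k - i)) • ((T - μ • 1) ^ i) v := by
      conv_lhs => rw [← sub_add_cancel T (μ • 1), hc.add_pow]
      rw [LinearMap.sum_apply]
      refine Finset.sum_congr rfl fun i _ => ?_
      rw [smul_pow, one_pow, mul_smul_comm, mul_one, ← Nat.cast_comm, ← nsmul_eq_mul,
        LinearMap.smul_apply, LinearMap.smul_apply, mul_smul, Nat.cast_smul_eq_nsmul]
    have hz : ∀ i, d ≤ i → ((T - μ • 1) ^ i) v = 0 := fun i hi => by
      rw [← Nat.sub_add_cancel hi, pow_add, Module.End.mul_apply, hv, map_zero]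
    rw [h1]
    -- Both ranges are enlarged to `k + 1 + d`: the extra terms vanish by the binomial coefficient
    -- or by `hv`. The length `d` no longer depends on `k`.
    refine (Finset.sum_subset (Finset.range_subset_range.2 (Nat.le_add_right (k + 1) d))
      fun i _ hi => ?_).trans (Finset.sum_subset
        (Finset.range_subset_range.2 (Nat.le_add_left d (k + 1))) fun i _ hi => ?_).symm
    · rw [Nat.choose_eq_zero_of_lt (by simpa using hi)]; simp
    · rw [hz i (by simpa using hi), smul_zero]
  simp_rw [hpow, Finset.smul_sum]
  refine hasSum_sum fun i _ => ?_
  convert! (hasSum_choose_mul_pow_mul_inv_pow i h).smul_const (((T - μ • 1) ^ i) v) using 2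
  rw [smul_smul, mul_comm]

/-- The value at `∑ μ, f μ` of the resolvent of `T`, for generalized eigenvectors `f μ` of order
at most `d`, by its partial fraction expansion. -/
noncomputable def resolventSum (T : Module.End ℂ V) (d : ℕ) (f : ℂ →₀ V) (z : ℂ) : V :=
  ∑ μ ∈ f.support, ∑ i ∈ Finset.range d, ((z - μ) ^ (i + 1))⁻¹ • ((T - μ • 1) ^ i) (f μ)

theorem hasSum_resolventSum {T : Module.End ℂ V} {d : ℕ} {f : ℂ →₀ V}
    (hf : ∀ μ : ℂ, ((T - μ • 1) ^ d) (f μ) = 0) {z : ℂ} (hz : ∀ μ ∈ f.support, ‖μ‖ < ‖z‖) :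
    HasSum (fun k : ℕ => (z ^ (k + 1))⁻¹ • (T ^ k) (f.sum fun _ v => v))
      (resolventSum T d f z) := by
  simp_rw [Finsupp.sum, map_sum, Finset.smul_sum]
  exact hasSum_sum fun μ hμ => hasSum_inv_pow_smul_pow_apply T (hz μ hμ) (hf μ)

/-- The leading coefficient of the resolvent at a point `ρ ω` of the circle of radius `ρ`,
approached radially. -/
theorem tendsto_pow_smul_resolventSum {T : Module.End ℂ V} {d : ℕ} {f : ℂ →₀ V}
    (hf : ∀ μ : ℂ, ((T - μ • 1) ^ d) (f μ) = 0) (ρ : ℝ) {ω : ℂ} (hω : ω ≠ 0) (q : ℕ)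
    (hq : ((T - (ρ * ω) • 1) ^ (q + 1)) (f (ρ * ω)) = 0) :
    Tendsto (fun t : ℝ => ((t - ρ : ℝ) : ℂ) ^ (q + 1) • resolventSum T d f (t * ω)) (𝓝[>] ρ)
      (𝓝 ((ω ^ (q + 1))⁻¹ • ((T - (ρ * ω) • 1) ^ q) (f (ρ * ω)))) := by
  classical
  have h0 : Tendsto (fun t : ℝ => ((t - ρ : ℝ) : ℂ)) (𝓝[>] ρ) (𝓝 0) := by
    have : ContinuousAt (fun t : ℝ => ((t - ρ : ℝ) : ℂ)) ρ := by fun_prop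
    simpa [ContinuousAt] using this.tendsto.mono_left nhdsWithin_le_nhds
  -- Termwise limits. At `μ = ρω`, a term with `i < q` keeps a positive power of `t - ρ`, and one
  -- with `i > q` is zero by `hq`; at other `μ` nothing is singular.
  set c : ℂ → ℕ → V := fun μ i =>
    if μ = ρ * ω ∧ i = q then (ω ^ (q + 1))⁻¹ • ((T - (ρ * ω) • 1) ^ q) (f (ρ * ω)) else 0
    with hc
  have hterm : ∀ μ : ℂ, ∀ i : ℕ, Tendsto (fun t : ℝ => ((t - ρ : ℝ) : ℂ) ^ (q + 1) •
      (((t * ω - μ) ^ (i + 1))⁻¹ • ((T - μ • 1) ^ i) (f μ))) (𝓝[>] ρ) (𝓝 (c μ i)) := by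
    intro μ i
    by_cases hμ : μ = ρ * ω
    · subst hμ
      rcases lt_trichotomy i q with hi | rfl | hi
      · have hci : c (ρ * ω) i = 0 := by simp [hc, hi.ne]
        rw [hci]
        have h1 : Tendsto (fun t : ℝ => (((t - ρ : ℝ) : ℂ) ^ (q - i) * (ω ^ (i + 1))⁻¹) •
            ((T - (ρ * ω) • 1) ^ i) (f (ρ * ω))) (𝓝[>] ρ) (𝓝 0) := by
          have := ((h0.pow (q - i)).mul_const (ω ^ (i + 1))⁻¹).smul_const
            (((T - ((ρ : ℂ) * ω) • 1) ^ i) (f (ρ * ω)))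
          simpa [zero_pow (Nat.sub_ne_zero_of_lt hi)] using this
        refine h1.congr' ?_
        filter_upwards [self_mem_nhdsWithin] with t ht
        have ht' : ((t - ρ : ℝ) : ℂ) ≠ 0 := by
          exact_mod_cast (sub_pos.2 ht).ne'
        rw [smul_smul]
        congr 1
        rw [← sub_mul, ← Complex.ofReal_sub, mul_pow, show q + 1 = (q - i) + (i + 1) by omega,
          pow_add]
        field_simp
        rw [← pow_add]
      · have hci : c (ρ * ω) i =
            (ω ^ (i + 1))⁻¹ • ((T - (ρ * ω) • 1) ^ i) (f (ρ * ω)) := by simp [hc]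
        rw [hci]
        refine tendsto_const_nhds.congr' ?_
        filter_upwards [self_mem_nhdsWithin] with t ht
        have ht' : ((t - ρ : ℝ) : ℂ) ≠ 0 := by
          exact_mod_cast (sub_pos.2 ht).ne'
        rw [smul_smul]
        congr 1
        rw [← sub_mul, ← Complex.ofReal_sub, mul_pow]
        field_simp
      · have hci : c (ρ * ω) i = 0 := by simp [hc, hi.ne']
        have hz : ((T - ((ρ : ℂ) * ω) • 1) ^ i) (f (ρ * ω)) = 0 := by
          rw [← Nat.sub_add_cancel (Nat.succ_le_of_lt hi), pow_add, Module.End.mul_apply, hq,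
            map_zero]
        simp [hci, hz]
    · have hci : c μ i = 0 := by simp [hc, hμ]
      rw [hci]
      have hne : ((ρ : ℂ) * ω - μ) ^ (i + 1) ≠ 0 := pow_ne_zero _ (sub_ne_zero.2 (Ne.symm hμ))
      have h1 : Tendsto (fun t : ℝ => (((t : ℂ) * ω - μ) ^ (i + 1))⁻¹) (𝓝[>] ρ)
          (𝓝 (((ρ : ℂ) * ω - μ) ^ (i + 1))⁻¹) := by
        refine Tendsto.inv₀ ?_ hne
        have : ContinuousAt (fun t : ℝ => ((t : ℂ) * ω - μ) ^ (i + 1)) ρ := by fun_prop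
        exact this.tendsto.mono_left nhdsWithin_le_nhds
      have := (h0.pow (q + 1)).smul (h1.smul_const (((T - μ • 1) ^ i) (f μ)))
      simpa using this
  have hsum := tendsto_finsetSum f.support fun μ _ =>
    tendsto_finsetSum (Finset.range d) fun i _ => hterm μ i
  have hval : ∑ μ ∈ f.support, ∑ i ∈ Finset.range d, c μ i =
      (ω ^ (q + 1))⁻¹ • ((T - (ρ * ω) • 1) ^ q) (f (ρ * ω)) := by
    -- When the index `(ρω, q)` is absent from the double sum, the claimed limit is itself zero.
    by_cases hs : (ρ : ℂ) * ω ∈ f.support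
    · rw [Finset.sum_eq_single_of_mem _ hs fun μ _ hμ => by simp [hc, hμ]]
      by_cases hd : q < d
      · rw [Finset.sum_eq_single_of_mem q (by simpa using hd) fun i _ hi => by simp [hc, hi]]
        simp [hc]
      · have hz : ((T - ((ρ : ℂ) * ω) • 1) ^ q) (f (ρ * ω)) = 0 := by
          rw [← Nat.sub_add_cancel (not_lt.1 hd), pow_add, Module.End.mul_apply, hf, map_zero]
        simp [hc, hz]
    · rw [Finsupp.notMem_support_iff.1 hs, map_zero, smul_zero]
      refine Finset.sum_eq_zero fun μ hμ => Finset.sum_eq_zero fun i _ => ?_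
      have : μ ≠ ρ * ω := fun h => hs (h ▸ hμ)
      simp [hc, this]
  rw [hval] at hsum
  refine hsum.congr fun t => ?_
  simp_rw [resolventSum, Finset.smul_sum]

end Resolvent

/-! ### A functional that is uniformly positive on the cone -/

section Cone

/-- A closed pointed convex cone admits a uniformly positive continuous functional. -/
theorem exists_strongDual_forall_mul_norm_le {E : Type*} [NormedAddCommGroup E] [NormedSpace ℝ E]
    [FiniteDimensional ℝ E] (K : PointedCone ℝ E) (hcl : IsClosed (K : Set E))
    (hpt : ∀ x ∈ K, -x ∈ K → x = 0) :
    ∃ g : StrongDual ℝ E, ∃ c > 0, ∀ y ∈ K, c * ‖y‖ ≤ g y := by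
  have : ProperSpace E := FiniteDimensional.proper ℝ E
  let S : Set E := Metric.sphere 0 1 ∩ K
  have hS : IsCompact S := (isCompact_sphere 0 1).inter_right hcl
  have hf : ∀ x : S, ∃ f : StrongDual ℝ E, (∀ y ∈ K, 0 ≤ f y) ∧ 0 < f x := by
    rintro ⟨x, hx1, hxK⟩
    have hx0 : x ≠ 0 := by
      rintro rfl; simp at hx1
    obtain ⟨f, hf, hfx⟩ := ProperCone.hyperplane_separation_point
      (⟨K, hcl⟩ : ProperCone ℝ E) (x₀ := -x) fun h => hx0 (hpt x hxK h)
    exact ⟨f, hf, by simpa using hfx⟩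
  choose f hf hfx using hf
  -- By compactness of the unit section `S`, finitely many functionals suffice; their sum is
  -- positive on `S`, hence bounded below there.
  obtain ⟨s, hs⟩ := hS.elim_finite_subcover (fun x : S => {y | 0 < f x y})
    (fun x => isOpen_lt continuous_const (f x).continuous)
    fun x hx => Set.mem_iUnion.2 ⟨⟨x, hx⟩, hfx ⟨x, hx⟩⟩
  have hpos : ∀ y ∈ S, 0 < (∑ x ∈ s, f x) y := by
    intro y hy
    obtain ⟨x, hxs, hx⟩ := Set.mem_iUnion₂.1 (hs hy)
    rw [sum_apply]
    exact Finset.sum_pos' (fun z _ => hf z y hy.2) ⟨x, hxs, hx⟩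
  obtain ⟨c, hc, hcS⟩ := hS.exists_forall_le' (∑ x ∈ s, f x).continuous.continuousOn hpos
  refine ⟨∑ x ∈ s, f x, c, hc, fun y hy => ?_⟩
  rcases eq_or_ne y 0 with rfl | hy0
  · simp
  have hn : 0 < ‖y‖ := norm_pos_iff.2 hy0
  have h1 : ‖y‖⁻¹ • y ∈ S := by
    refine ⟨?_, K.smul_mem (by positivity) hy⟩
    simp [norm_smul, hn.ne']
  have h2 := hcS _ h1
  rw [map_smul, smul_eq_mul] at h2
  calc c * ‖y‖ ≤ (‖y‖⁻¹ * (∑ x ∈ s, f x) y) * ‖y‖ := by gcongr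
    _ = (∑ x ∈ s, f x) y := by field_simp

end Cone

/-! ### Real vectors inside complex ones -/

section Complexification

variable {n : ℕ}

/-- The componentwise real part of a complex vector. -/
def reVec (v : Fin n → ℂ) : Fin n → ℝ := fun i => (v i).re

@[simp] theorem reVec_cVec (x : Fin n → ℝ) : reVec (cVec x) = x := rfl

theorem cVec_injective : Function.Injective (cVec : (Fin n → ℝ) → Fin n → ℂ) :=
  Function.LeftInverse.injective reVec_cVec

@[simp] theorem cVec_zero : cVec (0 : Fin n → ℝ) = 0 := by ext; simp [cVec]

theorem cVec_eq_zero_iff {x : Fin n → ℝ} : cVec x = 0 ↔ x = 0 :=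
  ⟨fun h => cVec_injective (h.trans cVec_zero.symm), fun h => h ▸ cVec_zero⟩

theorem cVec_add (x y : Fin n → ℝ) : cVec (x + y) = cVec x + cVec y := by ext; simp [cVec]

theorem cVec_smul (a : ℝ) (x : Fin n → ℝ) : cVec (a • x) = (a : ℂ) • cVec x := by
  ext; simp [cVec]

theorem norm_cVec (x : Fin n → ℝ) : ‖cVec x‖ = ‖x‖ := by
  simp only [Pi.norm_def, cVec]
  congr 2
  ext i
  simp

theorem continuous_cVec : Continuous (cVec : (Fin n → ℝ) → Fin n → ℂ) :=
  continuous_pi fun i => Complex.continuous_ofReal.comp (continuous_apply i)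

theorem continuous_reVec : Continuous (reVec : (Fin n → ℂ) → Fin n → ℝ) :=
  continuous_pi fun i => Complex.continuous_re.comp (continuous_apply i)

theorem toLin'_cMat_cVec (A : Matrix (Fin n) (Fin n) ℝ) (x : Fin n → ℝ) :
    Matrix.toLin' (cMat A) (cVec x) = cVec (A.mulVec x) := by
  ext i
  simp [cMat, cVec, Matrix.mulVec, dotProduct]

theorem toLin'_sub_smul_one (M : Matrix (Fin n) (Fin n) ℂ) (μ : ℂ) :
    Matrix.toLin' (M - μ • 1) = Matrix.toLin' M - μ • 1 := by
  rw [map_sub, map_smul, Matrix.toLin'_one]; rfl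

theorem pow_sub_smul_one_mulVec (M : Matrix (Fin n) (Fin n) ℂ) (μ : ℂ) (k : ℕ)
    (v : Fin n → ℂ) :
    ((M - μ • (1 : Matrix (Fin n) (Fin n) ℂ)) ^ k).mulVec v =
      ((Matrix.toLin' M - μ • 1) ^ k) v := by
  rw [← toLin'_sub_smul_one, ← Matrix.toLin'_pow, Matrix.toLin'_apply]

theorem cMat_sub_smul_one (A : Matrix (Fin n) (Fin n) ℝ) (r : ℝ) :
    cMat (A - r • 1) = cMat A - (r : ℂ) • 1 := by
  ext i j
  by_cases h : i = j <;> simp [cMat, h]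

theorem toLin'_cMat_pow_cVec (A : Matrix (Fin n) (Fin n) ℝ) (k : ℕ) (x : Fin n → ℝ) :
    (Matrix.toLin' (cMat A) ^ k) (cVec x) = cVec ((A ^ k).mulVec x) := by
  induction k with
  | zero => simp
  | succ k ih =>
    rw [pow_succ', Module.End.mul_apply, ih, toLin'_cMat_cVec, pow_succ', Matrix.mulVec_mulVec]

theorem cVec_shiftPow (A : Matrix (Fin n) (Fin n) ℝ) (r : ℝ) (j : ℕ) (x : Fin n → ℝ) :
    cVec (shiftPow A r j x) = ((Matrix.toLin' (cMat A) - (r : ℂ) • 1) ^ j) (cVec x) := by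
  rw [shiftPow, ← toLin'_cMat_pow_cVec, cMat_sub_smul_one, toLin'_sub_smul_one]

theorem shiftPow_zero (A : Matrix (Fin n) (Fin n) ℝ) (r : ℝ) (x : Fin n → ℝ) :
    shiftPow A r 0 x = x := by simp [shiftPow]

theorem shiftPow_succ (A : Matrix (Fin n) (Fin n) ℝ) (r : ℝ) (j : ℕ) (x : Fin n → ℝ) :
    shiftPow A r (j + 1) x = A.mulVec (shiftPow A r j x) - r • shiftPow A r j x := by
  simp [shiftPow, pow_succ', ← Matrix.mulVec_mulVec, Matrix.sub_mulVec, Matrix.smul_mulVec]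

/-- A complex sum of real vectors is real. -/
theorem hasSum_cVec {a : ℕ → Fin n → ℝ} {R : Fin n → ℂ} (h : HasSum (fun k => cVec (a k)) R) :
    HasSum a (reVec R) ∧ R = cVec (reVec R) := by
  have h1 : HasSum a (reVec R) := Pi.hasSum.2 fun i => by
    simpa [cVec, reVec] using Complex.hasSum_re (Pi.hasSum.1 h i)
  refine ⟨h1, h.unique (Pi.hasSum.2 fun i => ?_)⟩
  exact Complex.hasSum_ofReal.2 (Pi.hasSum.1 h1 i)

end Complexification

/-! ### Representations, orders and local spectral radius -/

section Rep

variable {n : ℕ} {M : Matrix (Fin n) (Fin n) ℂ}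

theorem pow_apply_eq_zero_of_mem_maxGenEigenspace {μ : ℂ} {v : Fin n → ℂ}
    (hv : v ∈ Module.End.maxGenEigenspace (Matrix.toLin' M) μ) :
    ((Matrix.toLin' M - μ • 1) ^ n) v = 0 := by
  rw [Module.End.maxGenEigenspace_eq_genEigenspace_finrank, Module.finrank_fin_fun,
    Module.End.mem_genEigenspace_nat, LinearMap.mem_ker] at hv
  exact hv

/-- For a generalized eigenvector `v ≠ 0` for `μ`, the operator `T - ν` with `ν ≠ μ` is
injective on the multiples of `v`. -/
theorem eq_zero_of_pow_sub_apply_eq_zero {μ ν : ℂ} (h : ν ≠ μ) {v : Fin n → ℂ}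
    (hv : v ∈ Module.End.maxGenEigenspace (Matrix.toLin' M) μ) {m : ℕ}
    (hm : ((Matrix.toLin' M - ν • 1) ^ m) v = 0) : v = 0 :=
  Submodule.disjoint_def.1 (Module.End.disjoint_genEigenspace (Matrix.toLin' M) h ⊤ ⊤) v
    ((Module.End.mem_maxGenEigenspace _ _ _).2 ⟨m, hm⟩) hv

theorem pow_sub_smul_one_comm (T : Module.End ℂ (Fin n → ℂ)) (μ ν : ℂ) (i j : ℕ) :
    Commute ((T - μ • 1) ^ i) ((T - ν • 1) ^ j) := by
  refine Commute.pow_pow ?_ i j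
  have h1 : ∀ c : ℂ, Commute T (c • 1) := fun c => (Commute.one_right _).smul_right c
  have h2 : Commute (μ • (1 : Module.End ℂ (Fin n → ℂ))) (ν • 1) :=
    (Commute.one_right _).smul_right ν
  exact ((Commute.refl T).sub_right (h1 ν)).sub_left ((h1 μ).symm.sub_right h2)

theorem pow_sub_apply_mem_maxGenEigenspace {μ : ℂ} (ν : ℂ) (m : ℕ) {v : Fin n → ℂ}
    (hv : v ∈ Module.End.maxGenEigenspace (Matrix.toLin' M) μ) :
    ((Matrix.toLin' M - ν • 1) ^ m) v ∈ Module.End.maxGenEigenspace (Matrix.toLin' M) μ := by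
  refine (Module.End.mem_maxGenEigenspace _ _ _).2 ⟨n, ?_⟩
  rw [← Module.End.mul_apply, (pow_sub_smul_one_comm _ μ ν n m).eq, Module.End.mul_apply,
    pow_apply_eq_zero_of_mem_maxGenEigenspace hv, map_zero]

/-- Orders are positive by definition, so the case `k = 0` needs `v ≠ 0`. -/
theorem pow_sub_apply_eq_zero_iff {μ : ℂ} {v : Fin n → ℂ}
    (hv : v ∈ Module.End.maxGenEigenspace (Matrix.toLin' M) μ) (hv0 : v ≠ 0) (k : ℕ) :
    ((Matrix.toLin' M - μ • 1) ^ k) v = 0 ↔ genEigenOrder M μ v ≤ k := by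
  simp only [genEigenOrder, pow_sub_smul_one_mulVec]
  constructor
  · intro h
    refine Nat.sInf_le ⟨Nat.pos_of_ne_zero ?_, h⟩
    rintro rfl
    exact hv0 h
  · intro h
    obtain ⟨-, h1⟩ := Nat.sInf_mem (s := {p : ℕ | 0 < p ∧ ((Matrix.toLin' M - μ • 1) ^ p) v = 0})
      ⟨n + 1, n.succ_pos, by
        rw [pow_succ', Module.End.mul_apply, pow_apply_eq_zero_of_mem_maxGenEigenspace hv,
          map_zero]⟩
    rw [← Nat.sub_add_cancel h, pow_add, Module.End.mul_apply, h1, map_zero]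

/-- Generalized eigenspaces are invariant under polynomials in the matrix, so the representation of
`(A - ν)ᵐx` is read off from that of `x`. -/
theorem IsGenEigenRep.map_pow_sub {x : Fin n → ℂ} {f : ℂ →₀ (Fin n → ℂ)}
    (hf : IsGenEigenRep M x f) (ν : ℂ) (m : ℕ) :
    IsGenEigenRep M (((Matrix.toLin' M - ν • 1) ^ m) x)
      (f.mapRange (fun v => ((Matrix.toLin' M - ν • 1) ^ m) v) (map_zero _)) := by
  refine ⟨fun μ => ?_, ?_⟩
  · rw [Finsupp.mapRange_apply]
    exact pow_sub_apply_mem_maxGenEigenspace ν m (hf.1 μ)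
  · rw [Finsupp.sum_mapRange_index (fun _ => rfl), ← hf.2, Finsupp.sum, Finsupp.sum, map_sum]

theorem isGenEigenRep_single {μ : ℂ} {v : Fin n → ℂ}
    (hv : v ∈ Module.End.maxGenEigenspace (Matrix.toLin' M) μ) :
    IsGenEigenRep M v (Finsupp.single μ v) := by
  refine ⟨fun ν => ?_, by simp⟩
  rcases eq_or_ne μ ν with rfl | h
  · simpa using hv
  · simp [h]

theorem ord_le_genEigenOrder {μ : ℂ} {v : Fin n → ℂ}
    (hv : v ∈ Module.End.maxGenEigenspace (Matrix.toLin' M) μ) :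
    ord M v ≤ genEigenOrder M μ v := by
  rw [ord, ← (isGenEigenRep_single hv).eq_genEigenRep]
  refine Finset.sup_le fun ν hν => ?_
  have : ν = μ := by
    by_contra h
    have := (Finset.mem_filter.1 hν).1
    simp [Ne.symm h] at this
  subst this
  simp

theorem norm_le_localRho {x : Fin n → ℂ} {μ : ℂ} (hμ : μ ∈ (genEigenRep M x).support) :
    ‖μ‖ ≤ localRho M x := by
  have := Finset.le_sup (f := fun μ : ℂ => ‖μ‖₊) hμ
  exact_mod_cast this

theorem localRho_nonneg (x : Fin n → ℂ) : 0 ≤ localRho M x := NNReal.coe_nonneg _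

theorem exists_norm_eq_localRho {x : Fin n → ℂ} (hx : x ≠ 0) :
    ∃ μ, genEigenRep M x μ ≠ 0 ∧ ‖μ‖ = localRho M x := by
  have hne : (genEigenRep M x).support.Nonempty := by
    rw [Finsupp.support_nonempty_iff]
    intro h
    have := (isGenEigenRep_genEigenRep M x).2
    rw [h] at this
    exact hx (by simpa using this.symm)
  obtain ⟨μ, hμ, h⟩ := Finset.exists_mem_eq_sup _ hne fun μ : ℂ => ‖μ‖₊
  refine ⟨μ, by simpa using hμ, ?_⟩
  rw [localRho, h, coe_nnnorm]

theorem mem_spectrum_of_mem_maxGenEigenspace {μ : ℂ} {v : Fin n → ℂ}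
    (hv : v ∈ Module.End.maxGenEigenspace (Matrix.toLin' M) μ) (hv0 : v ≠ 0) :
    μ ∈ spectrum ℂ M := by
  rw [← Matrix.spectrum_toLin', ← Module.End.hasEigenvalue_iff_mem_spectrum]
  by_contra h
  rw [Module.End.hasEigenvalue_iff, not_not] at h
  have h2 : Function.Injective (Matrix.toLin' M - μ • 1 : Module.End ℂ (Fin n → ℂ)) := by
    rw [← LinearMap.ker_eq_bot, ← h, Module.End.eigenspace_def]
  have h3 : Function.Injective ((Matrix.toLin' M - μ • 1 : Module.End ℂ (Fin n → ℂ)) ^ n) := by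
    rw [Module.End.coe_pow]; exact h2.iterate n
  exact hv0 (h3 ((pow_apply_eq_zero_of_mem_maxGenEigenspace hv).trans (map_zero _).symm))

end Rep

/-! ### Local Perron–Frobenius theory -/

section LocalPerronFrobenius

variable {n : ℕ} {K : PointedCone ℝ (Fin n → ℝ)} {A : Matrix (Fin n) (Fin n) ℝ}

theorem preservers_pow_mulVec_mem (hA : A ∈ preservers K) {x : Fin n → ℝ} (hx : x ∈ K) (k : ℕ) :
    (A ^ k).mulVec x ∈ K := by
  induction k with
  | zero => simpa using hx
  | succ k ih => rw [pow_succ', ← Matrix.mulVec_mulVec]; exact hA _ ih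

theorem IsGenEigenRep.pow_apply_eq_zero {M : Matrix (Fin n) (Fin n) ℂ} {x : Fin n → ℂ}
    {f : ℂ →₀ (Fin n → ℂ)} (hf : IsGenEigenRep M x f) (μ : ℂ) :
    ((Matrix.toLin' M - μ • 1) ^ n) (f μ) = 0 :=
  pow_apply_eq_zero_of_mem_maxGenEigenspace (hf.1 μ)

theorem IsGenEigenRep.hasSum_cVec_resolventSum {x : Fin n → ℝ} {f : ℂ →₀ (Fin n → ℂ)}
    (hf : IsGenEigenRep (cMat A) (cVec x) f) {z : ℂ} (hz : ∀ μ ∈ f.support, ‖μ‖ < ‖z‖) :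
    HasSum (fun k : ℕ => (z ^ (k + 1))⁻¹ • cVec ((A ^ k).mulVec x))
      (resolventSum (Matrix.toLin' (cMat A)) n f z) := by
  have := hasSum_resolventSum hf.pow_apply_eq_zero hz
  simpa only [hf.2, toLin'_cMat_pow_cVec] using this

/-- On the positive half-line the resolvent series is a real series. -/
theorem IsGenEigenRep.hasSum_real {x : Fin n → ℝ} {f : ℂ →₀ (Fin n → ℂ)}
    (hf : IsGenEigenRep (cMat A) (cVec x) f) {t : ℝ} (ht : 0 ≤ t)
    (hft : ∀ μ ∈ f.support, ‖μ‖ < t) :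
    HasSum (fun k : ℕ => (t ^ (k + 1))⁻¹ • (A ^ k).mulVec x)
        (reVec (resolventSum (Matrix.toLin' (cMat A)) n f t)) ∧
      resolventSum (Matrix.toLin' (cMat A)) n f t =
        cVec (reVec (resolventSum (Matrix.toLin' (cMat A)) n f t)) := by
  refine hasSum_cVec ?_
  have := hf.hasSum_cVec_resolventSum (z := (t : ℂ)) (by simpa [abs_of_nonneg ht] using hft)
  simpa [cVec_smul] using this

/-- Along the orbit of a cone, the resolvent on a circle is dominated by its value at the
positive point of the circle. -/
theorem IsGenEigenRep.exists_norm_resolventSum_le (hcl : IsClosed (K : Set (Fin n → ℝ)))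
    (hpt : ∀ x ∈ K, -x ∈ K → x = 0) {x : Fin n → ℝ} {f : ℂ →₀ (Fin n → ℂ)}
    (hf : IsGenEigenRep (cMat A) (cVec x) f) (hx : ∀ k, (A ^ k).mulVec x ∈ K) :
    ∃ C : ℝ, ∀ t : ℝ, 0 ≤ t → (∀ μ ∈ f.support, ‖μ‖ < t) → ∀ ω : ℂ, ‖ω‖ = 1 →
      ‖resolventSum (Matrix.toLin' (cMat A)) n f (t * ω)‖ ≤
        C * ‖resolventSum (Matrix.toLin' (cMat A)) n f t‖ := by
  obtain ⟨g, c, hc, hg⟩ := exists_strongDual_forall_mul_norm_le K hcl hpt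
  -- The factor `c⁻¹` compares `‖Aᵏx‖` with `g (Aᵏx)` term by term; `‖g‖` bounds `g` at the sum of
  -- the series at `t`.
  refine ⟨c⁻¹ * ‖g‖, fun t ht hft ω hω => ?_⟩
  obtain ⟨hs, hR⟩ := hf.hasSum_real ht hft
  have h1 := (hs.mapL g).mul_left c⁻¹
  have hz : ‖(t : ℂ) * ω‖ = t := by simp [hω, abs_of_nonneg ht]
  have h2 := hf.hasSum_cVec_resolventSum (z := t * ω) (by simpa only [hz] using hft)
  refine (h2.norm_le_of_bounded h1 fun k => ?_).trans ?_
  · rw [norm_smul, norm_inv, norm_pow, hz, norm_cVec, map_smul, smul_eq_mul]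
    have := hg _ (hx k)
    calc (t ^ (k + 1))⁻¹ * ‖(A ^ k).mulVec x‖
        = c⁻¹ * ((t ^ (k + 1))⁻¹ * (c * ‖(A ^ k).mulVec x‖)) := by field_simp
      _ ≤ _ := by gcongr
  · rw [mul_assoc]
    gcongr
    refine (le_abs_self _).trans ((g.le_opNorm _).trans ?_)
    rw [← norm_cVec, ← hR]

/-- Local Perron–Frobenius theorem: along the orbit of a cone, the order of the component at
the positive point of the peripheral circle dominates the orders of the other peripheral
components. -/
theorem IsGenEigenRep.pow_sub_apply_eq_zero_of_norm_eq (hcl : IsClosed (K : Set (Fin n → ℝ)))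
    (hpt : ∀ x ∈ K, -x ∈ K → x = 0) {x : Fin n → ℝ} {f : ℂ →₀ (Fin n → ℂ)}
    (hf : IsGenEigenRep (cMat A) (cVec x) f) (hx : ∀ k, (A ^ k).mulVec x ∈ K) {ρ : ℝ}
    (hρ : ∀ μ ∈ f.support, ‖μ‖ ≤ ρ) {q : ℕ}
    (hq : ((Matrix.toLin' (cMat A) - (ρ : ℂ) • 1) ^ q) (f ρ) = 0) {μ : ℂ} (hμ : ‖μ‖ = ρ) :
    ((Matrix.toLin' (cMat A) - μ • 1) ^ q) (f μ) = 0 := by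
  have hρ0 : 0 ≤ ρ := hμ ▸ norm_nonneg μ
  rcases hρ0.eq_or_lt with h0 | hpos
  · have : μ = ρ := by rw [← h0] at hμ ⊢; simpa using hμ
    rwa [this]
  have hρc : (ρ : ℂ) ≠ 0 := by exact_mod_cast hpos.ne'
  obtain ⟨ω, rfl⟩ : ∃ ω : ℂ, ρ * ω = μ := ⟨μ / ρ, mul_div_cancel₀ _ hρc⟩
  have hω : ‖ω‖ = 1 := by
    rw [norm_mul, Complex.norm_real, Real.norm_of_nonneg hρ0] at hμ
    exact mul_left_cancel₀ hpos.ne' (by rw [hμ, mul_one])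
  have hω0 : ω ≠ 0 := by rintro rfl; simp at hω
  obtain ⟨C, hC⟩ := hf.exists_norm_resolventSum_le hcl hpt hx
  have hz : ∀ j, ((Matrix.toLin' (cMat A) - (ρ : ℂ) • 1) ^ (q + j)) (f ρ) = 0 := fun j => by
    rw [add_comm, pow_add, Module.End.mul_apply, hq, map_zero]
  -- Descent from exponent `q + n`, which always kills the component. At each stage the leading
  -- coefficient at `ρ` is zero by `hq`, so by domination the one at `ρω` is zero too.
  have key : ∀ j, ((Matrix.toLin' (cMat A) - (ρ * ω) • 1) ^ (q + j)) (f (ρ * ω)) = 0 →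
      ((Matrix.toLin' (cMat A) - (ρ * ω) • 1) ^ q) (f (ρ * ω)) = 0 := by
    intro j
    induction j with
    | zero => exact id
    | succ j ih =>
      intro hj
      refine ih ?_
      have t1 := tendsto_pow_smul_resolventSum hf.pow_apply_eq_zero ρ hω0 (q + j) hj
      have t2 := tendsto_pow_smul_resolventSum hf.pow_apply_eq_zero ρ one_ne_zero (q + j)
        (by simpa only [mul_one, add_assoc] using hz (j + 1))
      simp only [mul_one, hz j, smul_zero] at t2
      have t3 : Tendsto (fun t : ℝ => ((t - ρ : ℝ) : ℂ) ^ (q + j + 1) •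
          resolventSum (Matrix.toLin' (cMat A)) n f (t * ω)) (𝓝[>] ρ) (𝓝 0) := by
        have t4 := t2.norm.const_mul C
        rw [norm_zero, mul_zero] at t4
        refine squeeze_zero_norm' ?_ t4
        filter_upwards [self_mem_nhdsWithin] with t ht
        have ht' : ρ < t := ht
        rw [norm_smul, norm_smul, mul_left_comm]
        gcongr
        exact hC t (hρ0.trans ht'.le) (fun μ hμ => (hρ μ hμ).trans_lt ht') ω hω
      have := tendsto_nhds_unique t1 t3
      exact (smul_eq_zero.1 this).resolve_left (inv_ne_zero (pow_ne_zero _ hω0))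
  refine key n ?_
  rw [pow_add, Module.End.mul_apply, hf.pow_apply_eq_zero, map_zero]

/-- The peripheral spectrum of a nonzero vector of a cone contains the local spectral radius. -/
theorem genEigenRep_localRho_ne_zero (hcl : IsClosed (K : Set (Fin n → ℝ)))
    (hpt : ∀ x ∈ K, -x ∈ K → x = 0) {x : Fin n → ℝ} (hx0 : x ≠ 0)
    (hx : ∀ k, (A ^ k).mulVec x ∈ K) :
    genEigenRep (cMat A) (cVec x) (localRho (cMat A) (cVec x)) ≠ 0 := by
  intro h
  obtain ⟨μ, hμ0, hμ⟩ := exists_norm_eq_localRho (M := cMat A) (cVec_eq_zero_iff.not.2 hx0)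
  refine hμ0 ?_
  -- With `q = 0`: a zero component at `ρ` would make every peripheral component zero.
  simpa using (isGenEigenRep_genEigenRep (cMat A) (cVec x)).pow_sub_apply_eq_zero_of_norm_eq
    hcl hpt hx (fun _ => norm_le_localRho) (q := 0) (by simpa using h) hμ

/-- A nonzero `z` in the cone with `A z ≥ ρ z` has local spectral radius at least `ρ`. -/
theorem IsGenEigenRep.exists_le_norm (hK : IsProper K) (hA : A ∈ preservers K)
    {z : Fin n → ℝ} (hz : z ∈ K) (hz0 : z ≠ 0) {f : ℂ →₀ (Fin n → ℂ)}
    (hf : IsGenEigenRep (cMat A) (cVec z) f) {ρ : ℝ} (hρ : 0 ≤ ρ)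
    (h : A.mulVec z - ρ • z ∈ K) : ∃ μ ∈ f.support, ρ ≤ ‖μ‖ := by
  by_contra! hlt
  obtain ⟨g, c, hc, hg⟩ :=
    exists_strongDual_forall_mul_norm_le K hK.isClosed hK.eq_zero_of_neg_mem
  have hρ0 : 0 < ρ := by
    refine hρ.lt_of_ne fun h0 => ?_
    have : f = 0 := by
      rw [← Finsupp.support_eq_empty, Finset.eq_empty_iff_forall_notMem]
      exact fun μ hμ => ((norm_nonneg μ).trans_lt (hlt μ hμ)).ne h0
    have h2 := hf.2
    rw [this, Finsupp.sum_zero_index] at h2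
    exact hz0 (cVec_eq_zero_iff.1 h2.symm)
  have hmono : ∀ k, ρ ^ k * g z ≤ g ((A ^ k).mulVec z) := by
    intro k
    induction k with
    | zero => simp
    | succ k ih =>
      have h1 := (mul_nonneg hc.le (norm_nonneg _)).trans
        (hg _ (preservers_pow_mulVec_mem hA h k))
      rw [Matrix.mulVec_sub, Matrix.mulVec_smul, Matrix.mulVec_mulVec, ← pow_succ, map_sub,
        map_smul, smul_eq_mul] at h1
      calc ρ ^ (k + 1) * g z = ρ * (ρ ^ k * g z) := by ring
        _ ≤ ρ * g ((A ^ k).mulVec z) := by gcongr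
        _ ≤ _ := by linarith
  have hgz : 0 < g z := (mul_pos hc (norm_pos_iff.2 hz0)).trans_le (hg z hz)
  -- Since all eigenvalues are assumed smaller than `ρ` in modulus, the series converges at `t = ρ`;
  -- yet by `hmono` its terms under `g` stay above `ρ⁻¹ * g z > 0`.
  have ht := ((hf.hasSum_real hρ hlt).1.mapL g).summable.tendsto_atTop_zero
  refine (ge_of_tendsto' ht fun k => ?_ : ρ⁻¹ * g z ≤ 0).not_gt (by positivity)
  rw [map_smul, smul_eq_mul]
  calc ρ⁻¹ * g z = (ρ ^ (k + 1))⁻¹ * (ρ ^ k * g z) := by rw [pow_succ]; field_simp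
    _ ≤ _ := by gcongr; exact hmono k

end LocalPerronFrobenius

/-! ### Spectral radius, and the cone as a spanning set -/

section SpectralRadius

variable {n : ℕ}

theorem exists_mem_spectrum_norm_eq_rho (hn : 0 < n) (M : Matrix (Fin n) (Fin n) ℂ) :
    ∃ μ ∈ spectrum ℂ M, ‖μ‖ = rho M := by
  let _ := Matrix.linftyOpNormedRing (n := Fin n) (α := ℂ)
  let _ := Matrix.linftyOpNormedAlgebra (R := ℂ) (n := Fin n) (α := ℂ)
  have : Nonempty (Fin n) := ⟨⟨0, hn⟩⟩
  have : CompleteSpace (Matrix (Fin n) (Fin n) ℂ) := FiniteDimensional.complete ℂ _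
  obtain ⟨μ, hμ, h⟩ := spectrum.exists_nnnorm_eq_spectralRadius M
  refine ⟨μ, hμ, ?_⟩
  rw [rho, ← h]
  simp

theorem norm_le_rho {M : Matrix (Fin n) (Fin n) ℂ} {μ : ℂ} (hμ : μ ∈ spectrum ℂ M) :
    ‖μ‖ ≤ rho M := by
  -- Needed because `toReal` sends `⊤` to `0`.
  have hfin : spectralRadius ℂ M ≠ ⊤ := by
    let _ := Matrix.linftyOpNormedRing (n := Fin n) (α := ℂ)
    let _ := Matrix.linftyOpNormedAlgebra (R := ℂ) (n := Fin n) (α := ℂ)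
    have : CompleteSpace (Matrix (Fin n) (Fin n) ℂ) := FiniteDimensional.complete ℂ _
    obtain ⟨ν, -, h⟩ := spectrum.exists_nnnorm_eq_spectralRadius_of_nonempty ⟨μ, hμ⟩
    rw [← h]
    exact ENNReal.coe_ne_top
  have h : (‖μ‖₊ : ENNReal) ≤ spectralRadius ℂ M := le_iSup₂ (α := ENNReal) μ hμ
  simpa [rho] using ENNReal.toReal_mono hfin h

/-- The vectors of a cone with nonempty interior have no common linear equation. -/
theorem exists_mem_apply_cVec_ne_zero {K : PointedCone ℝ (Fin n → ℝ)}
    (hint : (interior (K : Set (Fin n → ℝ))).Nonempty) {V : Type*} [AddCommGroup V] [Module ℂ V]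
    {L : (Fin n → ℂ) →ₗ[ℂ] V} (hL : L ≠ 0) : ∃ x ∈ K, L (cVec x) ≠ 0 := by
  by_contra! h
  obtain ⟨x₀, hx₀⟩ := hint
  refine hL (LinearMap.pi_ext' fun i => LinearMap.ext_ring ?_)
  -- An interior point and its small shift along a basis vector both lie in `K`; if `L` kills both,
  -- it kills the basis vector.
  have hcont : Tendsto (fun ε : ℝ => x₀ + ε • (Pi.single i 1 : Fin n → ℝ)) (𝓝[>] 0) (𝓝 x₀) := by
    have : ContinuousAt (fun ε : ℝ => x₀ + ε • (Pi.single i 1 : Fin n → ℝ)) 0 := by fun_prop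
    simpa [ContinuousAt] using this.tendsto.mono_left nhdsWithin_le_nhds
  obtain ⟨ε, hεK, hε⟩ := ((hcont.eventually (isOpen_interior.mem_nhds hx₀)).and
    self_mem_nhdsWithin).exists
  have hε0 : (ε : ℂ) ≠ 0 := by exact_mod_cast (Set.mem_Ioi.1 hε).ne'
  have h1 := h _ (interior_subset hεK)
  rw [cVec_add, cVec_smul, map_add, h _ (interior_subset hx₀), zero_add, map_smul] at h1
  have h2 : cVec (Pi.single i 1 : Fin n → ℝ) = Pi.single i 1 := by
    ext j
    by_cases hj : j = i
    · subst hj; simp [cVec]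
    · simp [cVec, hj]
  simpa [h2] using (smul_eq_zero.1 h1).resolve_left hε0

end SpectralRadius

/-! ### Eigenvectors in the cone, the corollary and the bounds on `m` -/

variable {n : ℕ} {K : PointedCone ℝ (Fin n → ℝ)} {A : Matrix (Fin n) (Fin n) ℝ}

/-- Every eigenvalue occurs in the representation of some vector of the cone. -/
theorem exists_mem_genEigenRep_ne_zero (hint : (interior (K : Set (Fin n → ℝ))).Nonempty)
    {M : Matrix (Fin n) (Fin n) ℂ} {μ : ℂ} (hμ : μ ∈ spectrum ℂ M) :
    ∃ x ∈ K, genEigenRep M (cVec x) μ ≠ 0 := by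
  set W : Submodule ℂ (Fin n → ℂ) :=
    ⨆ ν, ⨆ (_ : ν ≠ μ), Module.End.maxGenEigenspace (Matrix.toLin' M) ν with hW
  rw [← Matrix.spectrum_toLin', ← Module.End.hasEigenvalue_iff_mem_spectrum] at hμ
  obtain ⟨v, hv⟩ := hμ.exists_hasEigenvector
  have hvW : v ∉ W := fun h => hv.2 <| Submodule.disjoint_def.1
    (iSupIndep_def.1 (Module.End.independent_maxGenEigenspace (Matrix.toLin' M)) μ) v
    (Module.End.genEigenspace_le_maximal _ _ 1 hv.1) h
  -- A vector of `K` outside `W` must have a component at `μ`, so it is enough that the quotient map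
  -- by `W` is nonzero.
  have hL : W.mkQ ≠ 0 := fun h => hvW <| by
    rw [← Submodule.Quotient.mk_eq_zero, ← Submodule.mkQ_apply, h, LinearMap.zero_apply]
  obtain ⟨x, hx, hxW⟩ := exists_mem_apply_cVec_ne_zero hint hL
  refine ⟨x, hx, fun h0 => hxW ?_⟩
  rw [Submodule.mkQ_apply, Submodule.Quotient.mk_eq_zero]
  have hf := isGenEigenRep_genEigenRep M (cVec x)
  rw [← hf.2]
  refine Submodule.sum_mem _ fun ν hν => ?_
  have hne : ν ≠ μ := by rintro rfl; exact (Finsupp.mem_support_iff.1 hν) h0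
  exact Submodule.mem_iSup_of_mem ν (Submodule.mem_iSup_of_mem hne (hf.1 ν))

theorem localRho_le_rho {M : Matrix (Fin n) (Fin n) ℂ} {x : Fin n → ℂ} (hx : x ≠ 0) :
    localRho M x ≤ rho M := by
  obtain ⟨μ, hμ0, hμ⟩ := exists_norm_eq_localRho (M := M) hx
  exact hμ ▸ norm_le_rho (mem_spectrum_of_mem_maxGenEigenspace
    ((isGenEigenRep_genEigenRep M x).1 μ) hμ0)

/-- The local spectral radius of a nonzero vector of a cone is an eigenvalue with an eigenvector
in the cone. -/
theorem exists_mem_mulVec_eq_localRho_smul (hK : IsProper K) {x : Fin n → ℝ} (hx0 : x ≠ 0)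
    (hx : ∀ k, (A ^ k).mulVec x ∈ K) :
    ∃ y ∈ K, y ≠ 0 ∧ A.mulVec y = localRho (cMat A) (cVec x) • y := by
  set T := Matrix.toLin' (cMat A) with hT
  set ρ := localRho (cMat A) (cVec x) with hρdef
  set f := genEigenRep (cMat A) (cVec x) with hfdef
  have hf : IsGenEigenRep (cMat A) (cVec x) f := isGenEigenRep_genEigenRep _ _
  have hf0 : f ρ ≠ 0 :=
    genEigenRep_localRho_ne_zero hK.isClosed hK.eq_zero_of_neg_mem hx0 hx
  have hord := pow_sub_apply_eq_zero_iff (hf.1 ρ) hf0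
  obtain ⟨q, hq⟩ : ∃ q, genEigenOrder (cMat A) ρ (f ρ) = q + 1 :=
    Nat.exists_eq_succ_of_ne_zero fun h => hf0 <| by simpa using (hord 0).2 h.le
  have hq1 : ((T - (ρ : ℂ) • 1) ^ (q + 1)) (f ρ) = 0 := (hord _).2 hq.le
  have hq0 : ((T - (ρ : ℂ) • 1) ^ q) (f ρ) ≠ 0 := fun h => by
    have := (hord _).1 h
    omega
  set w := ((T - (ρ : ℂ) • 1) ^ q) (f ρ) with hw
  -- The eigenvector is `w`, the end of the chain of `f ρ`. It is a limit of positive multiples of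
  -- the resolvent series, whose sums lie in the closed cone.
  have hlim := tendsto_pow_smul_resolventSum hf.pow_apply_eq_zero ρ one_ne_zero q
    (by simpa only [mul_one] using hq1)
  simp only [mul_one, one_pow, inv_one, one_smul] at hlim
  have hmem : ∀ᶠ t : ℝ in 𝓝[>] ρ, ((t - ρ : ℝ) : ℂ) ^ (q + 1) • resolventSum T n f t ∈
      cVec '' (K : Set (Fin n → ℝ)) := by
    filter_upwards [self_mem_nhdsWithin] with t ht
    have ht' : ρ < t := ht
    have ht0 : 0 ≤ t := (localRho_nonneg _).trans ht'.le
    obtain ⟨hs, hR⟩ := hf.hasSum_real ht0 fun μ hμ => (norm_le_localRho hμ).trans_lt ht'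
    have hRK : reVec (resolventSum T n f t) ∈ K :=
      hK.isClosed.mem_of_tendsto hs <| Eventually.of_forall fun s =>
        K.sum_mem fun k _ => K.smul_mem (by positivity) (hx k)
    refine ⟨(t - ρ) ^ (q + 1) • reVec (resolventSum T n f t),
      K.smul_mem (pow_nonneg (sub_nonneg.2 ht'.le) _) hRK, ?_⟩
    rw [cVec_smul, ← hR, Complex.ofReal_pow]
  have hclosed : IsClosed (cVec '' (K : Set (Fin n → ℝ))) := by
    have : cVec '' (K : Set (Fin n → ℝ)) =
        {v | cVec (reVec v) = v} ∩ reVec ⁻¹' (K : Set (Fin n → ℝ)) := by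
      ext v
      constructor
      · rintro ⟨y, hy, rfl⟩
        exact ⟨rfl, hy⟩
      · rintro ⟨h1, h2⟩
        exact ⟨_, h2, h1⟩
    rw [this]
    exact (isClosed_eq (continuous_cVec.comp continuous_reVec) continuous_id).inter
      (hK.isClosed.preimage continuous_reVec)
  obtain ⟨y, hyK, hyw⟩ := hclosed.mem_of_tendsto hlim hmem
  refine ⟨y, hyK, ?_, cVec_injective ?_⟩
  · rintro rfl
    exact hq0 (hyw.symm.trans cVec_zero)
  · rw [← toLin'_cMat_cVec, cVec_smul, hyw, ← sub_eq_zero]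
    rw [pow_succ', Module.End.mul_apply] at hq1
    exact hq1

/-- The Perron–Frobenius theorem for a cone. -/
theorem exists_mem_mulVec_eq_rho_smul (hn : 0 < n) (hK : IsProper K) (hA : A ∈ preservers K) :
    ∃ y ∈ K, y ≠ 0 ∧ A.mulVec y = rho (cMat A) • y := by
  obtain ⟨μ, hμ, hμρ⟩ := exists_mem_spectrum_norm_eq_rho hn (cMat A)
  obtain ⟨x, hxK, hxμ⟩ := exists_mem_genEigenRep_ne_zero hK.interior_nonempty hμ
  have hx0 : x ≠ 0 := by
    rintro rfl
    have h0 : IsGenEigenRep (cMat A) (cVec 0) 0 := ⟨fun _ => Submodule.zero_mem _, by simp⟩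
    rw [← h0.eq_genEigenRep] at hxμ
    exact hxμ rfl
  have h : localRho (cMat A) (cVec x) = rho (cMat A) :=
    (localRho_le_rho (cVec_eq_zero_iff.not.2 hx0)).antisymm
      (hμρ ▸ norm_le_localRho (Finsupp.mem_support_iff.2 hxμ))
  rw [← h]
  exact exists_mem_mulVec_eq_localRho_smul hK hx0 (preservers_pow_mulVec_mem hA hxK)

theorem shiftPow_of_mulVec_eq_smul {r : ℝ} {y : Fin n → ℝ} (hy : A.mulVec y = r • y) (lam : ℝ)
    (j : ℕ) : shiftPow A lam j y = (r - lam) ^ j • y := by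
  induction j with
  | zero => simp [shiftPow_zero]
  | succ j ih => rw [shiftPow_succ, ih, Matrix.mulVec_smul, hy]; module

theorem lt_rho_iff_exists_shiftPow_mem (hn : 0 < n) (hK : IsProper K) (hA : A ∈ preservers K)
    (lam : ℝ) : lam < rho (cMat A) ↔
      ∃ x ∈ K, ∀ j : ℕ, 0 < j → shiftPow A lam j x ∈ K ∧ shiftPow A lam j x ≠ 0 := by
  constructor
  · intro hlam
    obtain ⟨y, hyK, hy0, hy⟩ := exists_mem_mulVec_eq_rho_smul hn hK hA
    refine ⟨y, hyK, fun j _ => ?_⟩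
    rw [shiftPow_of_mulVec_eq_smul hy]
    have : 0 < (rho (cMat A) - lam) ^ j := pow_pos (sub_pos.2 hlam) j
    exact ⟨K.smul_mem this.le hyK, smul_ne_zero this.ne' hy0⟩
  · rintro ⟨x, -, hx⟩
    by_contra! hlam
    set B := A - lam • (1 : Matrix (Fin n) (Fin n) ℝ) with hB
    -- The cone condition is given from `j = 1` on, so the orbit under `B` starts at `Bx`. `B`
    -- itself need not preserve `K`, which is why the local results assume only that the orbit stays
    -- in `K`.
    set y := shiftPow A lam 1 x with hy
    have hyB : ∀ k, (B ^ k).mulVec y = shiftPow A lam (k + 1) x := fun k => by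
      rw [hy, shiftPow, shiftPow, Matrix.mulVec_mulVec, ← pow_add]
    have hy0 : y ≠ 0 := (hx 1 one_pos).2
    have horb : ∀ k, (B ^ k).mulVec y ∈ K := fun k => hyB k ▸ (hx _ k.succ_pos).1
    set r := localRho (cMat B) (cVec y) with hr
    have hrep := isGenEigenRep_genEigenRep (cMat B) (cVec y)
    have hr0 : 0 ≤ r := localRho_nonneg _
    obtain ⟨z, -, hz0, hz⟩ := exists_mem_mulVec_eq_localRho_smul hK hy0 horb
    have hspec : ((lam + r : ℝ) : ℂ) ∈ spectrum ℂ (cMat A) := by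
      refine mem_spectrum_of_mem_maxGenEigenspace (v := cVec z)
        ((Module.End.mem_maxGenEigenspace _ _ _).2 ⟨1, ?_⟩) (cVec_eq_zero_iff.not.2 hz0)
      rw [← cVec_shiftPow, cVec_eq_zero_iff, shiftPow_succ, shiftPow_zero]
      rw [hB, Matrix.sub_mulVec, Matrix.smul_mulVec, Matrix.one_mulVec, ← hr] at hz
      rw [add_smul, ← sub_sub, hz, sub_self]
    have hle := norm_le_rho hspec
    rw [Complex.norm_real] at hle
    -- `λ + r` is an eigenvalue of `A`, so `λ + r ≤ ρ(A) ≤ λ`. Then `y` has only the eigenvalue `0`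
    -- of `B`, and `Bⁿy = 0` contradicts the choice of `x`.
    have hr_zero : r = 0 := by linarith [le_abs_self (lam + r), Real.norm_eq_abs (lam + r)]
    have hsub : (genEigenRep (cMat B) (cVec y)).support ⊆ {0} := fun μ hμ => by
      have := norm_le_localRho hμ
      rw [← hr, hr_zero] at this
      simpa using this
    have hy1 : cVec y = genEigenRep (cMat B) (cVec y) 0 := by
      conv_lhs => rw [← hrep.2]
      rw [Finsupp.sum_of_support_subset _ hsub _ (by simp), Finset.sum_singleton]
    have hpow := hrep.pow_apply_eq_zero 0
    rw [← hy1, zero_smul, sub_zero, toLin'_cMat_pow_cVec, cVec_eq_zero_iff, hyB] at hpow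
    exact (hx _ n.succ_pos).2 hpow

theorem genEigenOrder_le_ord {M : Matrix (Fin n) (Fin n) ℂ} {x : Fin n → ℂ} {μ : ℂ}
    (hμ0 : genEigenRep M x μ ≠ 0) (hμ : ‖μ‖ = localRho M x) :
    genEigenOrder M μ (genEigenRep M x μ) ≤ ord M x := by
  classical
  exact Finset.le_sup (f := fun μ => genEigenOrder M μ (genEigenRep M x μ))
    (Finset.mem_filter.2 ⟨Finsupp.mem_support_iff.2 hμ0, hμ⟩)

theorem norm_localRho (M : Matrix (Fin n) (Fin n) ℂ) (x : Fin n → ℂ) :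
    ‖(localRho M x : ℂ)‖ = localRho M x := by
  rw [Complex.norm_real, Real.norm_of_nonneg (localRho_nonneg _)]

/-- If `(A - ρ_x I)ᵐ x` is in the cone, the order of a component of `x` at an eigenvalue of `Γ`
is at most `ord x - m`. -/
theorem add_genEigenOrder_le_ord (hK : IsProper K) (hA : A ∈ preservers K) {x : Fin n → ℝ}
    {m : ℕ} (hm : shiftPow A (localRho (cMat A) (cVec x)) m x ∈ K) {μ : ℂ}
    (hμ : μ ∈ Gam (cMat A) (cVec x)) :
    m + genEigenOrder (cMat A) μ (genEigenRep (cMat A) (cVec x) μ) ≤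
      ord (cMat A) (cVec x) := by
  classical
  obtain ⟨hμs, hμn, hμρ⟩ := Finset.mem_filter.1 hμ
  set ρ := localRho (cMat A) (cVec x) with hρdef
  set f := genEigenRep (cMat A) (cVec x) with hfdef
  have hf : IsGenEigenRep (cMat A) (cVec x) f := isGenEigenRep_genEigenRep _ _
  have hμ0 : f μ ≠ 0 := Finsupp.mem_support_iff.1 hμs
  have hord := pow_sub_apply_eq_zero_iff (hf.1 μ) hμ0
  obtain ⟨q, hq⟩ : ∃ q, genEigenOrder (cMat A) μ (f μ) = q + 1 :=
    Nat.exists_eq_succ_of_ne_zero fun h => hμ0 <| by simpa using (hord 0).2 h.le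
  have hg := hf.map_pow_sub (ρ : ℂ) m
  rw [← cVec_shiftPow] at hg
  -- Otherwise `(A - ρ)ᵐx` has order at most `q` at `ρ`, hence at `μ`; injectivity of `A - ρ` on the
  -- generalized eigenspace of `μ` would then give `f μ` order at most `q`.
  have hkey : ((Matrix.toLin' (cMat A) - (ρ : ℂ) • 1) ^ (q + m)) (f ρ) ≠ 0 := by
    intro h
    rw [pow_add, Module.End.mul_apply] at h
    have h1 := hg.pow_sub_apply_eq_zero_of_norm_eq hK.isClosed hK.eq_zero_of_neg_mem
      (preservers_pow_mulVec_mem hA hm)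
      (fun ν hν => norm_le_localRho (Finsupp.support_mapRange hν)) (q := q)
      (by rw [Finsupp.mapRange_apply]; exact h) hμn
    rw [Finsupp.mapRange_apply, ← Module.End.mul_apply, (pow_sub_smul_one_comm _ _ _ _ _).eq,
      Module.End.mul_apply] at h1
    have h2 := eq_zero_of_pow_sub_apply_eq_zero (Ne.symm hμρ)
      (pow_sub_apply_mem_maxGenEigenspace μ q (hf.1 μ)) h1
    have := (hord q).1 h2
    omega
  have hρ0 : f ρ ≠ 0 := fun h => hkey (by rw [h, map_zero])
  have h3 := (pow_sub_apply_eq_zero_iff (hf.1 ρ) hρ0 (q + m)).not.1 hkey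
  have h4 := genEigenOrder_le_ord hρ0 (norm_localRho (cMat A) (cVec x))
  rw [← hfdef] at h4
  omega

/-- If `z = (A - ρ_x I)ᵏ x` is nonzero and `z`, `(A - ρ_x I) z` are in the cone, then `k < ord x`
provided that `Γ` is empty. -/
theorem lt_ord_of_Gam_eq_empty (hK : IsProper K) (hA : A ∈ preservers K) {x : Fin n → ℝ}
    {k : ℕ} (hk : shiftPow A (localRho (cMat A) (cVec x)) k x ∈ K)
    (hk0 : shiftPow A (localRho (cMat A) (cVec x)) k x ≠ 0)
    (hk1 : shiftPow A (localRho (cMat A) (cVec x)) (k + 1) x ∈ K)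
    (hΓ : Gam (cMat A) (cVec x) = ∅) : k < ord (cMat A) (cVec x) := by
  classical
  by_contra! hle
  set ρ := localRho (cMat A) (cVec x) with hρdef
  set f := genEigenRep (cMat A) (cVec x) with hfdef
  have hf : IsGenEigenRep (cMat A) (cVec x) f := isGenEigenRep_genEigenRep _ _
  have hg := hf.map_pow_sub (ρ : ℂ) k
  rw [← cVec_shiftPow] at hg
  rw [shiftPow_succ] at hk1
  obtain ⟨μ, hμ, hμρ⟩ := hg.exists_le_norm hK hA hk hk0 (localRho_nonneg _) hk1
  have hμf : μ ∈ f.support := Finsupp.support_mapRange hμ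
  have hμn : ‖μ‖ = ρ := (norm_le_localRho hμf).antisymm hμρ
  have hμe : μ = ρ := by
    by_contra h
    have : μ ∈ Gam (cMat A) (cVec x) := Finset.mem_filter.2 ⟨hμf, hμn, h⟩
    simp [hΓ] at this
  subst hμe
  rw [Finsupp.mem_support_iff, Finsupp.mapRange_apply] at hμ
  have hρ0 := Finsupp.mem_support_iff.1 hμf
  exact hμ ((pow_sub_apply_eq_zero_iff (hf.1 _) hρ0 k).2
    ((genEigenOrder_le_ord hρ0 hμn).trans hle))

end ConePreserving

open ConePreserving in
theorem theorem6p1 {n : ℕ} (hn : 0 < n) (K : PointedCone ℝ (Fin n → ℝ)) (hK : IsProper K)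
    (A : Matrix (Fin n) (Fin n) ℝ) (hA : A ∈ preservers K) :
    (∀ x ∈ K, x ≠ 0 → ∀ m : ℕ, 0 < m →
      shiftPow A (localRho (cMat A) (cVec x)) m x ∈ K →
      (∀ j < m, shiftPow A (localRho (cMat A) (cVec x)) j x ∈ K ∧
        shiftPow A (localRho (cMat A) (cVec x)) j x ≠ 0) →
      m ≤ ord (cMat A) (cVec x) ∧
      ∀ hΓ : (Gam (cMat A) (cVec x)).Nonempty,
        (m : ℤ) ≤ (ord (cMat A) (cVec x) : ℤ) -
          ((Gam (cMat A) (cVec x)).sup' hΓ fun μ =>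
            ord (cMat A) (genEigenRep (cMat A) (cVec x) μ) : ℕ)) ∧
    (∀ lam : ℝ, lam < rho (cMat A) ↔
      ∃ x ∈ K, ∀ j : ℕ, 0 < j → shiftPow A lam j x ∈ K ∧ shiftPow A lam j x ≠ 0) := by
  refine ⟨fun x _ _ m hm hmK hj => ⟨?_, fun hΓ => ?_⟩, lt_rho_iff_exists_shiftPow_mem hn hK hA⟩
  · rcases (Gam (cMat A) (cVec x)).eq_empty_or_nonempty with hΓ | ⟨μ, hμ⟩
    · obtain ⟨k, rfl⟩ := Nat.exists_eq_succ_of_ne_zero hm.ne'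
      obtain ⟨hk, hk0⟩ := hj k k.lt_succ_self
      exact lt_ord_of_Gam_eq_empty hK hA hk hk0 hmK hΓ
    · exact (Nat.le_add_right _ _).trans (add_genEigenOrder_le_ord hK hA hmK hμ)
  · obtain ⟨μ, hμ, hsup⟩ := Finset.exists_mem_eq_sup' hΓ fun μ =>
      ord (cMat A) (genEigenRep (cMat A) (cVec x) μ)
    have h1 := add_genEigenOrder_le_ord hK hA hmK hμ
    -- The maximum over `Γ` is subtracted, so an upper bound for the `ord` of a component suffices.
    have h2 := ord_le_genEigenOrder ((isGenEigenRep_genEigenRep (cMat A) (cVec x)).1 μ)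
    rw [hsup]
    omega
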